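/- Let $p$ be a prime, $r\ge 1$, let $X$ be a discrete memoryless source with finite alphabet $\mathcal X$ and distribution $P_X$, let the reconstruction alphabet be $\mathcal U=\mathbb Z_{p^r}$, let $d:\mathcal X\times\mathcal U\to[0,\infty)$ be a distortion measure, extended to words by $\hat d(x^n,u^n)=\frac1n\sum_{i=1}^n d(x_i,u_i)$, and let $D$ be a real number such that $\mathbb E\,d(X,U)\le D$ for at least one test channel $P_{U|X}$ from $\mathcal X$ to $\mathcal U$. Write $|t|^+=\max(t,0)$, with all logarithms and entropies to one fixed base. Then the minimum $$R_0=\min_{P_{U|X}:\ \mathbb E\,d(X,U)\le D}\Bigl[\log p^r-\min\bigl(H(U|X),\ r\,|H(U|X)-\log p^{r-1}|^+\bigr)\Bigr]$$ exists, and every rate $R\ge R_0$ is achieved at distortion $D$ by group codes, in the following sense. For every $\epsilon>0$ and all sufficiently large $n$ there are a $k\times n$ parity-check matrix $H$ over $\mathbb Z_{p^r}$ (for some $k$), an encoder $f:\mathcal X^n\to\{1,\dots,\theta\}$ and a decoder $g:\{1,\dots,\theta\}\to\mathcal U^n$ whose set of reconstruction words is exactly the group code $\{u^n\in\mathbb Z_{p^r}^n: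 Hu^n=0\}$, such that $$\tfrac1n\log\theta\le R+\epsilon,\qquad \bigl(1-\tfrac kn\bigr)\log p^r\le R+\epsilon,\qquad \mathbb E\,\hat d\bigl(X^n,g(f(X^n))\bigr)\le D+\epsilon .$$ -/

import Mathlib

open Filter

noncomputable section

/-- The group code of block length `n` over `ℤ/q` with parity-check matrix `H`, that is
`{u ∈ (ℤ/q)ⁿ : H u = 0}`, a subgroup of `(ℤ/q)ⁿ`. -/
def groupCode {q k n : ℕ} (H : Matrix (Fin k) (Fin n) (ZMod q)) :
    AddSubgroup (Fin n → ZMod q) :=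
  (LinearMap.ker H.mulVecLin).toAddSubgroup

/-- A group-based lossy coding scheme of block length `n` for source alphabet `𝒳` and
reconstruction alphabet `ℤ/q`: an encoder into an index set of size `θ` and a decoder, such that
the set of reconstruction words of the decoder is a group code, with a given `k × n` parity-check
matrix. -/
structure GroupCodingScheme (𝒳 : Type*) (q n : ℕ) where
  /-- number of rows of the parity-check matrix -/
  k : ℕ
  /-- parity-check matrix -/
  H : Matrix (Fin k) (Fin n) (ZMod q)
  /-- number of indices that the encoder may send -/
  θ : ℕ
  /-- encoder -/
  enc : (Fin n → 𝒳) → Fin θ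
  /-- decoder -/
  dec : Fin θ → (Fin n → ZMod q)
  /-- the reproduction codebook is the group code of `H` -/
  range_dec : Set.range dec = (groupCode H : Set (Fin n → ZMod q))

/-- The expectation of `(1/n) ∑ᵢ d(Xᵢ, Ûᵢ)`, where `Ûⁿ` is the decoder output and the source word
`Xⁿ` has the product distribution `∏ᵢ P(xᵢ)`. -/
def GroupCodingScheme.expectedDistortion {𝒳 : Type*} [Fintype 𝒳] {q n : ℕ}
    (S : GroupCodingScheme 𝒳 q n) (P : 𝒳 → ℝ) (d : 𝒳 → ZMod q → ℝ) : ℝ :=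
  ∑ x : Fin n → 𝒳, (∏ i, P (x i)) * ((1 / (n : ℝ)) * ∑ i, d (x i) (S.dec (S.enc x) i))

/-- The rate-distortion pair `(R, D)` is achievable by group-based coding schemes: for every
`ε > 0` and all sufficiently large `n` there is a group-based scheme of block length `n` with rate
at most `R + ε` and expected distortion at most `D + ε`. The rate `(1/n) log θ` of the
transmission system and the rate `(1 - k/n) log q` given by the parity-check matrix are both
bounded. -/
def GroupAchievable {𝒳 : Type*} [Fintype 𝒳] {q : ℕ} (P : 𝒳 → ℝ) (d : 𝒳 → ZMod q → ℝ)
    (R D : ℝ) : Prop :=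
  ∀ ε : ℝ, 0 < ε → ∀ᶠ n : ℕ in atTop, ∃ S : GroupCodingScheme 𝒳 q n,
    (1 / (n : ℝ)) * Real.log (S.θ : ℝ) ≤ R + ε ∧
    (1 - (S.k : ℝ) / (n : ℝ)) * Real.log (q : ℝ) ≤ R + ε ∧
    S.expectedDistortion P d ≤ D + ε

/-- The conditional entropy `H(U|X) = ∑ₓ P(x) H(U | X = x)` for `P_X = P`, `P_{U|X} = W`. -/
def condEntropy {𝒳 𝒰 : Type*} [Fintype 𝒳] [Fintype 𝒰] (P : 𝒳 → ℝ) (W : 𝒳 → 𝒰 → ℝ) : ℝ :=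
  ∑ x, P x * ∑ u, Real.negMulLog (W x u)

/-- The test channels `W = P_{U|X}` that meet the constraint `E d(X, U) ≤ D`. -/
def testChannels {𝒳 𝒰 : Type*} [Fintype 𝒳] [Fintype 𝒰] (P : 𝒳 → ℝ) (d : 𝒳 → 𝒰 → ℝ) (D : ℝ) :
    Set (𝒳 → 𝒰 → ℝ) :=
  {W | (∀ x, W x ∈ stdSimplex ℝ 𝒰) ∧ ∑ x, ∑ u, P x * W x u * d x u ≤ D}

/-- `log p^r - min (H(U|X), r |H(U|X) - log p^(r-1)|⁺)` for a test channel `W`. -/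
def groupRate {𝒳 : Type*} [Fintype 𝒳] (p r : ℕ) [Fact p.Prime] (P : 𝒳 → ℝ)
    (W : 𝒳 → ZMod (p ^ r) → ℝ) : ℝ :=
  Real.log ((p : ℝ) ^ r) -
    min (condEntropy P W) ((r : ℝ) * max (condEntropy P W - Real.log ((p : ℝ) ^ (r - 1))) 0)

end

/-! Random coding over parity-check matrices, with a second moment argument. Fix a test channel `W`
with conditional entropy `h > log p^(r-1)`. For most source words `x`, about `exp (n h)`
reconstruction words lie within the allowed distortion (`exists_many_words_within_distortion`). Draw
the `k × n` matrix `H` uniformly. A word `u` with a unit coordinate `u i` is a codeword with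
probability `p^(-rk)`. For a second word `v`, both are codewords with probability at most
`p^(-rk-jk)`, where `p^j` is the order of `v - (v i / u i) u`. Only `p^r p^(jn)` words `v` at most
have this vector killed by `p^j`, so the zero divisors inflate the variance in a controlled way.
Chebyshev gives `card_matrix_missing_le`: a set `A` of such words is missed with probability at most
`r p^r p^((r-1)n+k) / |A|`.

This vanishes when `(k/n) log p` stays below `h - log p^(r-1)`, which produces the factor `r` in the
rate `(1 - k/n) log p^r`. Words without a unit coordinate number at most `p^((r-1)n)` and are
discarded. The mean kernel size is at most `(r+1) p^(r(n-k))`, so one matrix is good for both size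
and covering (`exists_covering_matrix`), and minimum-distortion encoding finishes. If `h ≤ log
p^(r-1)`, the whole space serves as the code. The minimum over test channels is attained by
compactness, so one optimal channel settles every larger rate. -/

theorem exists_addOrderOf_apply_eq_pow {p r : ℕ} [Fact p.Prime] {ι : Type*} [Finite ι] [Nonempty ι]
    (w : ι → ZMod (p ^ r)) :
    ∃ j ≤ r, p ^ j • w = 0 ∧ ∃ i, addOrderOf (w i) = p ^ j := by
  have key : ∀ i, ∃ j ≤ r, addOrderOf (w i) = p ^ j := fun i =>
    (Nat.dvd_prime_pow Fact.out).1 (addOrderOf_dvd_of_nsmul_eq_zero (by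
      rw [nsmul_eq_mul, ZMod.natCast_self, zero_mul]))
  choose J hJr hJ using key
  -- Powers of `p` are totally ordered by divisibility, so the largest coordinate order is a
  -- multiple of all the others.
  obtain ⟨i, hi⟩ := Finite.exists_max J
  refine ⟨J i, hJr i, ?_, i, hJ i⟩
  ext l
  rw [Pi.smul_apply, Pi.zero_apply, ← addOrderOf_dvd_iff_nsmul_eq_zero, hJ l]
  exact pow_dvd_pow p (hi l)

/-! ### Counting orthogonal vectors and torsion vectors over `ℤ/p^r`. -/

section Counting

variable {p r : ℕ} [Fact p.Prime] {ι : Type*} [Fintype ι] [DecidableEq ι]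

open Finset

/-- A vector of additive order `p ^ j` is orthogonal to at most a fraction `p ^ (-j)` of all
vectors. -/
theorem exists_card_orthogonal_mul_le [Nonempty ι] (w : ι → ZMod (p ^ r)) :
    ∃ j ≤ r, p ^ j • w = 0 ∧
      #{h : ι → ZMod (p ^ r) | h ⬝ᵥ w = 0} * p ^ j ≤ (p ^ r) ^ Fintype.card ι := by
  obtain ⟨j, hj, hw, i, hi⟩ := exists_addOrderOf_apply_eq_pow w
  refine ⟨j, hj, hw, ?_⟩
  -- Translates of the orthogonal complement by `b e_i`, `b < p^j`, are disjoint: pairing with `w`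
  -- gives `b • w i`, and `w i` has order `p^j`.
  have := Finset.card_le_card_of_injOn
    (s := ({h : ι → ZMod (p ^ r) | h ⬝ᵥ w = 0} : Finset _) ×ˢ range (p ^ j))
    (t := (univ : Finset (ι → ZMod (p ^ r))))
    (fun z => z.1 + Pi.single i (z.2 : ZMod (p ^ r))) (fun _ _ => by simp) (by
      rintro ⟨h, b⟩ hz ⟨h', b'⟩ hz' e
      simp only [coe_product, coe_filter, mem_univ, true_and, coe_range, Set.mem_prod,
        Set.mem_ofPred_eq, Set.mem_Iio] at hz hz' e
      have e1 := congrArg (· ⬝ᵥ w) e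
      simp only [add_dotProduct, single_dotProduct, hz.1, hz'.1, zero_add] at e1
      have hb : b = b' := nsmul_injOn_Iio_addOrderOf (x := w i) (by simpa [hi] using hz.2)
        (by simpa [hi] using hz'.2) (by simpa [nsmul_eq_mul] using e1)
      subst hb
      simpa using e)
  simpa [card_product, ZMod.card] using this

/-- Changing the coordinate `h i` alone moves `h ⬝ᵥ u` through every residue exactly once. Equality,
not just a bound, is needed for the exact first moment in Chebyshev's inequality. -/
theorem card_orthogonal_mul_eq (u : ι → ZMod (p ^ r)) (i : ι) (hu : IsUnit (u i)) :
    #{h : ι → ZMod (p ^ r) | h ⬝ᵥ u = 0} * p ^ r = (p ^ r) ^ Fintype.card ι := by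
  obtain ⟨c, hc⟩ := hu.exists_left_inv
  have := Finset.card_nbij'
    (s := ({h : ι → ZMod (p ^ r) | h ⬝ᵥ u = 0} : Finset _) ×ˢ (univ : Finset (ZMod (p ^ r))))
    (t := (univ : Finset (ι → ZMod (p ^ r))))
    (fun z => z.1 + Pi.single i (z.2 * c))
    (fun h => (h - Pi.single i ((h ⬝ᵥ u) * c), h ⬝ᵥ u))
    (fun _ _ => by simp)
    (fun h _ => by simp [sub_dotProduct, mul_assoc, hc])
    (by
      rintro ⟨h, b⟩ hz
      simp only [coe_product, coe_filter, mem_univ, true_and, coe_univ, Set.mem_prod,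
        Set.mem_ofPred_eq] at hz
      simp [add_dotProduct, mul_assoc, hc, hz.1])
    (fun h _ => by simp)
  simpa [card_product, ZMod.card] using this

/-- The number of vectors orthogonal to both `u` and `v`, in terms of the order of the vector
`v - (v i / u i) u`. -/
theorem exists_card_orthogonal_pair_mul_le (u v : ι → ZMod (p ^ r)) (i : ι) (c : ZMod (p ^ r))
    (hc : c * u i = 1) :
    ∃ j ≤ r, p ^ j • (v - (v i * c) • u) = 0 ∧
      #{h : ι → ZMod (p ^ r) | h ⬝ᵥ u = 0 ∧ h ⬝ᵥ v = 0} * (p ^ r * p ^ j) ≤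
        (p ^ r) ^ Fintype.card ι := by
  have : Nonempty ι := ⟨i⟩
  obtain ⟨j, hj, hw, l, hl⟩ := exists_addOrderOf_apply_eq_pow (v - (v i * c) • u)
  refine ⟨j, hj, hw, ?_⟩
  set w := v - (v i * c) • u with hwdef
  have hwi : w i = 0 := by simp [hwdef, mul_assoc, hc]
  -- Since `w i = 0`, pairing the translate with `w` sees only `b` and recovers it; pairing with `u`
  -- then recovers `a`, because `u i` is a unit.
  have := Finset.card_le_card_of_injOn
    (s := ({h : ι → ZMod (p ^ r) | h ⬝ᵥ u = 0 ∧ h ⬝ᵥ v = 0} : Finset _) ×ˢ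
      ((univ : Finset (ZMod (p ^ r))) ×ˢ range (p ^ j)))
    (t := (univ : Finset (ι → ZMod (p ^ r))))
    (fun z => z.1 + Pi.single i z.2.1 + Pi.single l (z.2.2 : ZMod (p ^ r)))
    (fun _ _ => by simp) (by
      rintro ⟨h, a, b⟩ hz ⟨h', a', b'⟩ hz' e
      simp only [coe_product, coe_filter, mem_univ, true_and, coe_range, Set.mem_prod,
        Set.mem_ofPred_eq, Set.mem_Iio, coe_univ, Set.mem_univ] at hz hz' e
      have hw0 : ∀ g : ι → ZMod (p ^ r), g ⬝ᵥ u = 0 ∧ g ⬝ᵥ v = 0 → g ⬝ᵥ w = 0 := by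
        rintro g ⟨h1, h2⟩
        simp [hwdef, dotProduct_sub, dotProduct_smul, h1, h2]
      have e1 := congrArg (· ⬝ᵥ w) e
      simp only [add_dotProduct, single_dotProduct, hw0 h hz.1, hw0 h' hz'.1, zero_add, hwi,
        mul_zero] at e1
      have hb : b = b' := nsmul_injOn_Iio_addOrderOf (x := w l) (by simpa [hl] using hz.2)
        (by simpa [hl] using hz'.2) (by simpa [nsmul_eq_mul] using e1)
      subst hb
      have e2 := congrArg (· ⬝ᵥ u) e
      simp only [add_dotProduct, single_dotProduct, hz.1.1, hz'.1.1, zero_add,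
        add_left_inj] at e2
      have ha : a = a' := by
        have := congrArg (· * c) e2
        simpa [mul_assoc, mul_comm (u i) c, hc] using this
      subst ha
      simpa using e)
  simpa [card_product, ZMod.card] using this

theorem card_nsmul_eq_zero_le (j : ℕ) :
    #{w : ι → ZMod (p ^ r) | p ^ j • w = 0} ≤ (p ^ j) ^ Fintype.card ι := by
  have h1 : #{x : ZMod (p ^ r) | p ^ j • x = 0} ≤ p ^ j :=
    IsAddCyclic.card_nsmul_eq_zero_le (pow_pos (Fact.out : p.Prime).pos j)
  have h2 : ({w : ι → ZMod (p ^ r) | p ^ j • w = 0} : Finset _) =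
      Fintype.piFinset fun _ => ({x : ZMod (p ^ r) | p ^ j • x = 0} : Finset _) := by
    ext w
    simp [Fintype.mem_piFinset, funext_iff]
  rw [h2, Fintype.card_piFinset, prod_const, card_univ]
  exact Nat.pow_le_pow_left h1 _

/-- Non-units of `ℤ/p^r` are the multiples of `p`, hence are killed by `p^(r-1)`. -/
theorem card_forall_not_isUnit_le (hr : 1 ≤ r) :
    #{w : ι → ZMod (p ^ r) | ∀ i, ¬ IsUnit (w i)} ≤ (p ^ (r - 1)) ^ Fintype.card ι := by
  refine le_trans (card_le_card fun w => ?_) (card_nsmul_eq_zero_le (p := p) (r := r) (r - 1))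
  simp only [mem_filter, mem_univ, true_and]
  intro hw
  ext i
  have hi := hw i
  obtain ⟨m, hm⟩ := ZMod.natCast_zmod_surjective (w i)
  rw [← hm, ZMod.isUnit_iff_coprime, Nat.coprime_pow_right_iff (by omega), Nat.coprime_comm,
    (Fact.out : p.Prime).coprime_iff_not_dvd, not_not] at hi
  obtain ⟨t, rfl⟩ := hi
  rw [Pi.smul_apply, Pi.zero_apply, ← hm, nsmul_eq_mul, ← Nat.cast_mul, ← mul_assoc, ← pow_succ,
    Nat.sub_add_cancel hr, Nat.cast_mul, ZMod.natCast_self, zero_mul]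

/-- The scalar `v i * c` and the reduced vector together determine `v`; the scalar costs the factor
`p^r`. -/
theorem card_nsmul_reduced_eq_zero_le (u : ι → ZMod (p ^ r)) (i : ι) (c : ZMod (p ^ r)) (j : ℕ) :
    #{v : ι → ZMod (p ^ r) | p ^ j • (v - (v i * c) • u) = 0} ≤
      p ^ r * (p ^ j) ^ Fintype.card ι := by
  have := Finset.card_le_card_of_injOn
    (s := ({v : ι → ZMod (p ^ r) | p ^ j • (v - (v i * c) • u) = 0} : Finset _))
    (t := (univ : Finset (ZMod (p ^ r))) ×ˢ
      ({w : ι → ZMod (p ^ r) | p ^ j • w = 0} : Finset _))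
    (fun v => (v i * c, v - (v i * c) • u)) (fun v hv => by simpa using hv) (by
      intro v _ v' _ e
      simp only [Prod.mk.injEq] at e
      rw [e.1] at e
      simpa using e.2)
  refine this.trans ?_
  rw [card_product, card_univ, ZMod.card]
  exact Nat.mul_le_mul_left _ (card_nsmul_eq_zero_le j)

end Counting

/-! ### First and second moments for the kernel of a random matrix. -/

section RandomMatrix

variable {p r : ℕ} [Fact p.Prime] {ι : Type*} [Fintype ι] [DecidableEq ι]

open Finset

/-- Independence of the rows, in counting form. -/
theorem card_matrix_forall_row {α : Type*} [Fintype α] [DecidableEq α] (k : ℕ)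
    (Q : (ι → α) → Prop) [DecidablePred Q] :
    #{H : Matrix (Fin k) ι α | ∀ i, Q (H.row i)} = #{h : ι → α | Q h} ^ k := by
  have : #(Fintype.piFinset fun _ : Fin k => ({h : ι → α | Q h} : Finset _)) =
      #{h : ι → α | Q h} ^ k := by
    rw [Fintype.card_piFinset, prod_const, card_univ, Fintype.card_fin]
  rw [← this]
  refine card_nbij' Matrix.row Matrix.of ?_ ?_ (fun _ _ => rfl) (fun _ _ => rfl)
  · intro H hH
    simpa using hH
  · intro f hf
    have hf' : ∀ i, Q (f i) := by simpa using hf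
    exact mem_coe.2 (mem_filter.2 ⟨mem_univ _, hf'⟩)

theorem card_matrix_mulVec_eq_zero (k : ℕ) (u : ι → ZMod (p ^ r)) :
    #{H : Matrix (Fin k) ι (ZMod (p ^ r)) | H.mulVec u = 0} =
      #{h : ι → ZMod (p ^ r) | h ⬝ᵥ u = 0} ^ k := by
  rw [← card_matrix_forall_row]
  congr 1
  ext H
  simp only [mem_filter, mem_univ, true_and, funext_iff]
  rfl

theorem card_matrix_mulVec_eq_zero_and (k : ℕ) (u v : ι → ZMod (p ^ r)) :
    #{H : Matrix (Fin k) ι (ZMod (p ^ r)) | H.mulVec u = 0 ∧ H.mulVec v = 0} =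
      #{h : ι → ZMod (p ^ r) | h ⬝ᵥ u = 0 ∧ h ⬝ᵥ v = 0} ^ k := by
  rw [← card_matrix_forall_row]
  congr 1
  ext H
  simp only [mem_filter, mem_univ, true_and, funext_iff, forall_and]
  rfl

theorem pow_le_div_pow_of_mul_le {a b c : ℕ} (k : ℕ) (hb : 0 < b) (h : a * b ≤ c) :
    ((a ^ k : ℕ) : ℝ) ≤ (c : ℝ) ^ k / (b : ℝ) ^ k := by
  have hb' : (0 : ℝ) < b := by exact_mod_cast hb
  rw [← div_pow]
  push_cast
  refine pow_le_pow_left₀ (by positivity) ?_ k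
  rw [le_div_iff₀ hb']
  exact_mod_cast h

/-- The average size of the kernel of a random `k × ι` matrix over `ℤ/p^r`. -/
theorem sum_card_ker_le [Nonempty ι] (k : ℕ) (hk : k ≤ Fintype.card ι) :
    ∑ H : Matrix (Fin k) ι (ZMod (p ^ r)), (#{u : ι → ZMod (p ^ r) | H.mulVec u = 0} : ℝ) ≤
      ((p : ℝ) ^ r) ^ (Fintype.card ι * k) *
        ((r + 1) * ((p : ℝ) ^ r) ^ (Fintype.card ι - k)) := by
  set n := Fintype.card ι
  have hp : 0 < p := (Fact.out : p.Prime).pos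
  have hp1 : (1 : ℝ) ≤ p := by exact_mod_cast hp
  have hp0 : (0 : ℝ) < p := by exact_mod_cast hp
  -- The exponent `j` depends on `u`. Summing over all `j` with an indicator removes this
  -- dependence, so that the words can be counted for each fixed `j`.
  have h1 : ∀ u : ι → ZMod (p ^ r),
      (#{H : Matrix (Fin k) ι (ZMod (p ^ r)) | H.mulVec u = 0} : ℝ) ≤
        ∑ j ∈ range (r + 1), if p ^ j • u = 0 then
          ((p : ℝ) ^ r) ^ (n * k) / ((p : ℝ) ^ j) ^ k else 0 := by
    intro u
    obtain ⟨j, hj, hu, hc⟩ := exists_card_orthogonal_mul_le u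
    rw [card_matrix_mulVec_eq_zero]
    refine (pow_le_div_pow_of_mul_le k (pow_pos hp j) hc).trans ?_
    refine le_trans (le_of_eq ?_) (single_le_sum (f := fun j => if p ^ j • u = 0 then
      ((p : ℝ) ^ r) ^ (n * k) / ((p : ℝ) ^ j) ^ k else 0)
      (fun j _ => by split_ifs <;> positivity) (mem_range.2 (Nat.lt_succ_of_le hj)))
    simp only [if_pos hu]
    push_cast
    rw [pow_mul]
  have h2 : ∑ H : Matrix (Fin k) ι (ZMod (p ^ r)),
      (#{u : ι → ZMod (p ^ r) | H.mulVec u = 0} : ℝ) =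
      ∑ u : ι → ZMod (p ^ r), (#{H : Matrix (Fin k) ι (ZMod (p ^ r)) | H.mulVec u = 0} : ℝ) := by
    simp only [card_filter, Nat.cast_sum]
    exact sum_comm
  rw [h2]
  refine (sum_le_sum fun u _ => h1 u).trans ?_
  rw [sum_comm]
  have h3 : ∀ j ∈ range (r + 1), (∑ u : ι → ZMod (p ^ r), if p ^ j • u = 0 then
      ((p : ℝ) ^ r) ^ (n * k) / ((p : ℝ) ^ j) ^ k else 0) ≤
      ((p : ℝ) ^ r) ^ (n * k) * ((p : ℝ) ^ r) ^ (n - k) := by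
    intro j hj
    have hj' : j ≤ r := Nat.lt_succ_iff.1 (mem_range.1 hj)
    rw [← sum_filter, sum_const, nsmul_eq_mul]
    have hc : (#{w : ι → ZMod (p ^ r) | p ^ j • w = 0} : ℝ) ≤ ((p : ℝ) ^ j) ^ n := by
      exact_mod_cast card_nsmul_eq_zero_le (p := p) (r := r) (ι := ι) j
    refine (mul_le_mul_of_nonneg_right hc (by positivity)).trans ?_
    have : ((p : ℝ) ^ j) ^ n = ((p : ℝ) ^ j) ^ (n - k) * ((p : ℝ) ^ j) ^ k := by
      rw [← pow_add, Nat.sub_add_cancel hk]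
    rw [this, mul_div_assoc', mul_comm, div_le_iff₀ (by positivity)]
    have h4 : ((p : ℝ) ^ j) ^ (n - k) ≤ ((p : ℝ) ^ r) ^ (n - k) :=
      pow_le_pow_left₀ (by positivity) (pow_le_pow_right₀ hp1 hj') _
    calc _ = ((p : ℝ) ^ r) ^ (n * k) * ((p : ℝ) ^ j) ^ (n - k) * ((p : ℝ) ^ j) ^ k := by ring
      _ ≤ _ := by gcongr
  refine (sum_le_sum h3).trans (le_of_eq ?_)
  rw [sum_const, card_range, nsmul_eq_mul]
  push_cast
  ring

theorem sum_card_filter_sq {α β : Type*} [Fintype β] (A : Finset α) (Q : β → α → Prop)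
    [∀ b a, Decidable (Q b a)] :
    ∑ b, ((#{a ∈ A | Q b a} : ℝ)) ^ 2 = ∑ a ∈ A, ∑ a' ∈ A, (#{b | Q b a ∧ Q b a'} : ℝ) := by
  simp only [card_filter, Nat.cast_sum, sq, sum_mul_sum]
  rw [sum_comm]
  refine sum_congr rfl fun a _ => ?_
  rw [sum_comm]
  refine sum_congr rfl fun a' _ => sum_congr rfl fun b _ => ?_
  by_cases h : Q b a <;> by_cases h' : Q b a' <;> simp [h, h']

/-- Chebyshev's inequality at zero, for a counting variable. -/
theorem card_filter_eq_zero_mul_sq_le {β : Type*} [Fintype β] (N : β → ℝ) (μ V : ℝ)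
    (h1 : ∑ b, N b = Fintype.card β * μ) (h2 : ∑ b, N b ^ 2 ≤ Fintype.card β * (μ ^ 2 + V)) :
    (#{b | N b = 0} : ℝ) * μ ^ 2 ≤ Fintype.card β * V := by
  have h3 : (#{b | N b = 0} : ℝ) * μ ^ 2 ≤ ∑ b, (N b - μ) ^ 2 := by
    rw [← nsmul_eq_mul, ← sum_const, sum_filter]
    refine sum_le_sum fun b _ => ?_
    split_ifs with h
    · simp [h]
    · positivity
  have h4 : ∑ b, (N b - μ) ^ 2 = ∑ b, N b ^ 2 - 2 * μ * ∑ b, N b + Fintype.card β * μ ^ 2 := by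
    simp only [sub_sq, sum_add_distrib, sum_sub_distrib, sum_const, card_univ, nsmul_eq_mul,
      mul_sum]
    congr 2
    exact sum_congr rfl fun _ _ => by ring
  rw [h4, h1] at h3
  linarith

/-- Pairs are sorted by the order `p^j` of the reduced vector. The level `j = r` contributes at most
the square-of-the-mean term; the levels `j < r` form the excess, and each is at most its value at `j
= r - 1`. -/
theorem sum_card_matrix_pair_le (k : ℕ) (hk : k ≤ Fintype.card ι)
    (A : Finset (ι → ZMod (p ^ r))) (u : ι → ZMod (p ^ r)) (i : ι) (hu : IsUnit (u i)) :
    ∑ v ∈ A, (#{H : Matrix (Fin k) ι (ZMod (p ^ r)) | H.mulVec u = 0 ∧ H.mulVec v = 0} : ℝ) ≤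
      ((p : ℝ) ^ r) ^ (Fintype.card ι * k) * (#A / (((p : ℝ) ^ r) ^ k) ^ 2 +
        r * (p : ℝ) ^ r * (p : ℝ) ^ ((r - 1) * (Fintype.card ι - k)) / ((p : ℝ) ^ r) ^ k) := by
  set n := Fintype.card ι
  have hp : 0 < p := (Fact.out : p.Prime).pos
  have hp1 : (1 : ℝ) ≤ p := by exact_mod_cast hp
  have hp0 : (0 : ℝ) < p := by exact_mod_cast hp
  obtain ⟨c, hc⟩ := hu.exists_left_inv
  set T : ℝ := ((p : ℝ) ^ r) ^ (n * k) with hT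
  have h1 : ∀ v : ι → ZMod (p ^ r),
      (#{H : Matrix (Fin k) ι (ZMod (p ^ r)) | H.mulVec u = 0 ∧ H.mulVec v = 0} : ℝ) ≤
        ∑ j ∈ range (r + 1), if p ^ j • (v - (v i * c) • u) = 0 then
          T / ((p : ℝ) ^ r * (p : ℝ) ^ j) ^ k else 0 := by
    intro v
    obtain ⟨j, hj, hv, hcard⟩ := exists_card_orthogonal_pair_mul_le u v i c hc
    rw [card_matrix_mulVec_eq_zero_and]
    refine (pow_le_div_pow_of_mul_le k (Nat.mul_pos (pow_pos hp r) (pow_pos hp j)) hcard).trans ?_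
    refine le_trans (le_of_eq ?_) (single_le_sum
      (f := fun j => if p ^ j • (v - (v i * c) • u) = 0 then
        T / ((p : ℝ) ^ r * (p : ℝ) ^ j) ^ k else 0)
      (fun j _ => by split_ifs <;> positivity) (mem_range.2 (Nat.lt_succ_of_le hj)))
    simp only [if_pos hv]
    push_cast
    rw [hT, pow_mul]
  refine (sum_le_sum fun v _ => h1 v).trans ?_
  rw [sum_comm, sum_range_succ, add_comm, mul_add]
  refine add_le_add ?_ ?_
  · calc _ ≤ ∑ v ∈ A, T / ((p : ℝ) ^ r * (p : ℝ) ^ r) ^ k :=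
          sum_le_sum fun v _ => by split_ifs; exacts [le_rfl, by positivity]
      _ = _ := by rw [sum_const, nsmul_eq_mul]; ring
  · have h3 : ∀ j ∈ range r, (∑ v ∈ A, if p ^ j • (v - (v i * c) • u) = 0 then
        T / ((p : ℝ) ^ r * (p : ℝ) ^ j) ^ k else 0) ≤
        T * ((p : ℝ) ^ r * (p : ℝ) ^ ((r - 1) * (n - k)) / ((p : ℝ) ^ r) ^ k) := by
      intro j hj
      have hj' : j ≤ r - 1 := by have := mem_range.1 hj; omega
      calc _ ≤ ∑ v : ι → ZMod (p ^ r), (if p ^ j • (v - (v i * c) • u) = 0 then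
              T / ((p : ℝ) ^ r * (p : ℝ) ^ j) ^ k else 0) :=
            sum_le_sum_of_subset_of_nonneg (subset_univ _)
              fun v _ _ => by split_ifs <;> positivity
        _ = #{v : ι → ZMod (p ^ r) | p ^ j • (v - (v i * c) • u) = 0} *
              (T / ((p : ℝ) ^ r * (p : ℝ) ^ j) ^ k) := by
            rw [← sum_filter, sum_const, nsmul_eq_mul]
        _ ≤ ((p : ℝ) ^ r * ((p : ℝ) ^ j) ^ n) * (T / ((p : ℝ) ^ r * (p : ℝ) ^ j) ^ k) := by
            refine mul_le_mul_of_nonneg_right ?_ (by positivity)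
            exact_mod_cast card_nsmul_reduced_eq_zero_le u i c j
        _ = T * ((p : ℝ) ^ r * (p : ℝ) ^ (j * (n - k)) / ((p : ℝ) ^ r) ^ k) := by
            have : ((p : ℝ) ^ j) ^ n = (p : ℝ) ^ (j * (n - k)) * ((p : ℝ) ^ j) ^ k := by
              rw [pow_mul, ← pow_add, Nat.sub_add_cancel hk]
            rw [this, mul_pow]
            field_simp
        _ ≤ _ := by gcongr
    refine (sum_le_sum h3).trans (le_of_eq ?_)
    rw [sum_const, card_range, nsmul_eq_mul]
    ring

/-- The kernel of a random `k × ι` matrix misses a set `A` of vectors with an invertible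
coordinate with probability at most `r p^r p^((r-1)n+k) / |A|`. -/
theorem card_matrix_missing_le (hr : 1 ≤ r) (k : ℕ) (hk : k ≤ Fintype.card ι)
    (A : Finset (ι → ZMod (p ^ r))) (hA : ∀ u ∈ A, ∃ i, IsUnit (u i)) :
    (#{H : Matrix (Fin k) ι (ZMod (p ^ r)) | ∀ u ∈ A, H.mulVec u ≠ 0} : ℝ) * #A ≤
      ((p : ℝ) ^ r) ^ (Fintype.card ι * k) *
        (r * (p : ℝ) ^ r * (p : ℝ) ^ ((r - 1) * Fintype.card ι + k)) := by
  set n := Fintype.card ι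
  have hp : 0 < p := (Fact.out : p.Prime).pos
  have hp0 : (0 : ℝ) < p := by exact_mod_cast hp
  set T : ℝ := ((p : ℝ) ^ r) ^ (n * k) with hT
  rcases A.eq_empty_or_nonempty with rfl | hne
  · simp only [card_empty, Nat.cast_zero, mul_zero]
    positivity
  have hA0 : (0 : ℝ) < #A := by exact_mod_cast hne.card_pos
  set Q : ℝ := ((p : ℝ) ^ r) ^ k with hQ
  have hQ0 : 0 < Q := by positivity
  have hcard : (Fintype.card (Matrix (Fin k) ι (ZMod (p ^ r))) : ℝ) = T := by
    rw [← Nat.card_eq_fintype_card, Nat.card_congr (Matrix.of (m := Fin k) (n := ι)).symm]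
    simp [hT, pow_mul, n]
  set V : ℝ := #A * (r * (p : ℝ) ^ r * (p : ℝ) ^ ((r - 1) * (n - k)) / Q) with hV
  have key := card_filter_eq_zero_mul_sq_le
    (fun H : Matrix (Fin k) ι (ZMod (p ^ r)) => (#{u ∈ A | H.mulVec u = 0} : ℝ)) (#A / Q) V
    (by
      have : ∑ H : Matrix (Fin k) ι (ZMod (p ^ r)), (#{u ∈ A | H.mulVec u = 0} : ℝ) =
          ∑ u ∈ A, (#{H : Matrix (Fin k) ι (ZMod (p ^ r)) | H.mulVec u = 0} : ℝ) := by
        simp only [card_filter, Nat.cast_sum]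
        exact sum_comm
      rw [this, hcard]
      have h1 : ∀ u ∈ A, (#{H : Matrix (Fin k) ι (ZMod (p ^ r)) | H.mulVec u = 0} : ℝ) =
          T / Q := by
        intro u hu
        obtain ⟨i, hi⟩ := hA u hu
        have h2 : (#{h : ι → ZMod (p ^ r) | h ⬝ᵥ u = 0} : ℝ) * (p : ℝ) ^ r = ((p : ℝ) ^ r) ^ n := by
          exact_mod_cast card_orthogonal_mul_eq u i hi
        rw [card_matrix_mulVec_eq_zero, eq_div_iff hQ0.ne', hQ, hT, pow_mul, ← h2, mul_pow]
        push_cast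
        rfl
      rw [sum_congr rfl h1, sum_const, nsmul_eq_mul]
      ring)
    (by
      rw [sum_card_filter_sq, hcard]
      have h1 : ∀ u ∈ A, _ := fun u hu =>
        sum_card_matrix_pair_le k hk A u (hA u hu).choose (hA u hu).choose_spec
      refine (sum_le_sum h1).trans (le_of_eq ?_)
      rw [sum_const, nsmul_eq_mul, hV]
      ring)
  rw [hcard] at key
  have hset : ({H : Matrix (Fin k) ι (ZMod (p ^ r)) | ∀ u ∈ A, H.mulVec u ≠ 0} : Finset _) =
      ({H : Matrix (Fin k) ι (ZMod (p ^ r)) | (#{u ∈ A | H.mulVec u = 0} : ℝ) = 0} : Finset _) := by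
    ext H
    simp [filter_eq_empty_iff]
  rw [hset]
  set M : ℝ := (#{H : Matrix (Fin k) ι (ZMod (p ^ r)) | (#{u ∈ A | H.mulVec u = 0} : ℝ) = 0} : ℝ)
  have hexp : (p : ℝ) ^ ((r - 1) * (n - k)) * Q = (p : ℝ) ^ ((r - 1) * n + k) := by
    rw [hQ, ← pow_mul, ← pow_add]
    congr 1
    obtain ⟨m, hm⟩ := Nat.exists_eq_add_of_le hk
    obtain ⟨s, rfl⟩ := Nat.exists_eq_add_of_le' hr
    rw [hm]
    simp only [Nat.add_sub_cancel, Nat.add_sub_cancel_left]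
    ring
  -- Chebyshev's bound `M (#A / Q)^2 ≤ T V`, written so that `#A / Q^2` cancels.
  have h5 : M * #A * (#A / Q ^ 2) ≤
      T * (r * (p : ℝ) ^ r * (p : ℝ) ^ ((r - 1) * n + k)) * (#A / Q ^ 2) := by
    calc _ = M * (#A / Q) ^ 2 := by ring
      _ ≤ T * V := key
      _ = _ := by rw [hV, ← hexp]; field_simp
  exact le_of_mul_le_mul_right h5 (by positivity)

end RandomMatrix

/-! ### Exponential bounds and the number of low-distortion words. -/

section Typicality

variable {𝒳 𝒰 : Type*} [Fintype 𝒳] [Fintype 𝒰]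

open Finset

/-- The moment generating function equals 1 at zero, and its derivative there is the negative mean.
-/
theorem exists_pos_sum_mul_exp_lt_one {α : Type*} [Fintype α] (Q g : α → ℝ)
    (hQ : ∑ a, Q a = 1) (hg : ∑ a, Q a * g a < 0) :
    ∃ s : ℝ, 0 < s ∧ ∑ a, Q a * Real.exp (s * g a) < 1 := by
  have hderiv : HasDerivAt (fun s : ℝ => ∑ a, Q a * Real.exp (s * g a)) (∑ a, Q a * g a) 0 := by
    have : ∀ a ∈ (univ : Finset α),
        HasDerivAt (fun s : ℝ => Q a * Real.exp (s * g a)) (Q a * g a) 0 := by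
      intro a _
      have h1 : HasDerivAt (fun s : ℝ => s * g a) (g a) 0 := by
        simpa using (hasDerivAt_id (0 : ℝ)).mul_const (g a)
      simpa using h1.exp.const_mul (Q a)
    exact HasDerivAt.fun_sum this
  have h1 : ∀ᶠ s in nhdsWithin (0 : ℝ) (Set.Ioi 0), slope (fun s : ℝ =>
      ∑ a, Q a * Real.exp (s * g a)) 0 s < 0 :=
    (hasDerivAt_iff_tendsto_slope.1 hderiv).eventually_lt_const hg |>.filter_mono
      (nhdsWithin_mono _ fun s hs => ne_of_gt hs)
  obtain ⟨s, hs, hs0⟩ := (h1.and self_mem_nhdsWithin).exists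
  have hs0 : 0 < s := hs0
  refine ⟨s, hs0, ?_⟩
  rw [slope_def_field, div_neg_iff] at hs
  simp only [sub_zero, zero_mul, Real.exp_zero, mul_one, hQ] at hs
  rcases hs with h | h
  · linarith [h.2]
  · linarith [h.1]

/-- A Chernoff bound for the product law of a source and a channel. -/
theorem exists_chernoff_bound (P : 𝒳 → ℝ) (hP : P ∈ stdSimplex ℝ 𝒳) (W : 𝒳 → 𝒰 → ℝ)
    (hW : ∀ x, W x ∈ stdSimplex ℝ 𝒰) (g : 𝒳 → 𝒰 → ℝ)
    (hg : ∑ x, ∑ u, P x * W x u * g x u < 0) :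
    ∃ m : ℝ, 0 ≤ m ∧ m < 1 ∧ ∀ n : ℕ,
      ∑ x : Fin n → 𝒳, (∏ i, P (x i)) *
        ∑ u : Fin n → 𝒰 with 0 ≤ ∑ i, g (x i) (u i), ∏ i, W (x i) (u i) ≤ m ^ n := by
  obtain ⟨s, hs, hm⟩ := exists_pos_sum_mul_exp_lt_one (fun z : 𝒳 × 𝒰 => P z.1 * W z.1 z.2)
    (fun z => g z.1 z.2) (by
      rw [Fintype.sum_prod_type]
      simp only [← mul_sum, (hW _).2, mul_one, hP.2])
    (by rwa [Fintype.sum_prod_type])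
  rw [Fintype.sum_prod_type] at hm
  refine ⟨_, sum_nonneg fun x _ => sum_nonneg fun u _ =>
    mul_nonneg (mul_nonneg (hP.1 x) ((hW x).1 u)) (Real.exp_nonneg _), hm, fun n => ?_⟩
  have hPn : ∀ x : Fin n → 𝒳, 0 ≤ ∏ i, P (x i) := fun x => prod_nonneg fun i _ => hP.1 _
  have hWn : ∀ (x : Fin n → 𝒳) (u : Fin n → 𝒰), 0 ≤ ∏ i, W (x i) (u i) :=
    fun x u => prod_nonneg fun i _ => (hW _).1 _
  calc _ ≤ ∑ x : Fin n → 𝒳, (∏ i, P (x i)) *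
        ∑ u : Fin n → 𝒰, ∏ i, (W (x i) (u i) * Real.exp (s * g (x i) (u i))) := by
        refine sum_le_sum fun x _ => mul_le_mul_of_nonneg_left ?_ (hPn x)
        rw [sum_filter]
        refine sum_le_sum fun u _ => ?_
        rw [prod_mul_distrib, ← Real.exp_sum, ← mul_sum]
        split_ifs with h
        · exact le_mul_of_one_le_right (hWn x u) (Real.one_le_exp (mul_nonneg hs.le h))
        · exact mul_nonneg (hWn x u) (Real.exp_nonneg _)
    _ = ∑ x : Fin n → 𝒳, ∏ i, ∑ u, P (x i) * W (x i) u * Real.exp (s * g (x i) u) := by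
        classical
        refine sum_congr rfl fun x _ => ?_
        simp only [mul_assoc, ← mul_sum]
        rw [prod_mul_distrib, prod_univ_sum, Fintype.piFinset_univ]
    _ = ∏ _i : Fin n, ∑ x, ∑ u, P x * W x u * Real.exp (s * g x u) := by
        classical
        rw [prod_univ_sum, Fintype.piFinset_univ]
    _ = _ := by
        rw [prod_const, card_univ, Fintype.card_fin]

theorem sum_prod_eq_one {α : Type*} [Fintype α] {n : ℕ} (Q : Fin n → α → ℝ)
    (hQ : ∀ i, ∑ a, Q i a = 1) :
    ∑ a : Fin n → α, ∏ i, Q i (a i) = 1 := by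
  classical
  rw [← Fintype.piFinset_univ, ← prod_univ_sum]
  simp [hQ]

theorem condEntropy_eq (P : 𝒳 → ℝ) (W : 𝒳 → 𝒰 → ℝ) :
    condEntropy P W = -∑ x, ∑ u, P x * W x u * Real.log (W x u) := by
  simp only [condEntropy, mul_sum, ← sum_neg_distrib, Real.negMulLog]
  exact sum_congr rfl fun x _ => sum_congr rfl fun u _ => by ring

theorem condEntropy_le_log_card [Nonempty 𝒰] (P : 𝒳 → ℝ) (hP : P ∈ stdSimplex ℝ 𝒳)
    (W : 𝒳 → 𝒰 → ℝ) (hW : ∀ x, W x ∈ stdSimplex ℝ 𝒰) :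
    condEntropy P W ≤ Real.log (Fintype.card 𝒰) := by
  set N : ℝ := (Fintype.card 𝒰 : ℝ)
  have hN : 0 < N := Nat.cast_pos.2 Fintype.card_pos
  -- This is `log y ≤ y - 1` at `y = 1 / (t N)`; the correction `N⁻¹ - t` sums to zero over a
  -- distribution.
  have h1 : ∀ t : ℝ, 0 ≤ t → Real.negMulLog t ≤ t * Real.log N + (N⁻¹ - t) := by
    intro t ht
    rcases ht.eq_or_lt with rfl | ht
    · simp [hN.le]
    · have h2 := Real.log_le_sub_one_of_pos (x := (t * N)⁻¹) (by positivity)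
      rw [Real.log_inv, Real.log_mul ht.ne' hN.ne'] at h2
      have h3 := mul_le_mul_of_nonneg_left h2 ht.le
      have h4 : t * ((t * N)⁻¹ - 1) = N⁻¹ - t := by field_simp
      rw [h4] at h3
      rw [Real.negMulLog]
      linarith
  have h2 : ∀ x, ∑ u, Real.negMulLog (W x u) ≤ Real.log N := by
    intro x
    refine (sum_le_sum fun u _ => h1 _ ((hW x).1 u)).trans (le_of_eq ?_)
    rw [sum_add_distrib, ← sum_mul, (hW x).2, sum_sub_distrib, (hW x).2, sum_const, card_univ,
      nsmul_eq_mul, mul_inv_cancel₀ hN.ne']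
    ring
  calc condEntropy P W ≤ ∑ x, P x * Real.log N :=
        sum_le_sum fun x _ => mul_le_mul_of_nonneg_left (h2 x) (hP.1 x)
    _ = Real.log N := by rw [← sum_mul, hP.2, one_mul]

/-- For most source words `x` there are about `exp (n H(U|X))` reconstruction words within
distortion `D + e` of `x`. -/
theorem exists_many_words_within_distortion (P : 𝒳 → ℝ) (hP : P ∈ stdSimplex ℝ 𝒳)
    (d : 𝒳 → 𝒰 → ℝ) (D : ℝ) (W : 𝒳 → 𝒰 → ℝ) (hW : W ∈ testChannels P d D) (e : ℝ) (he : 0 < e) :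
    ∃ m : ℝ, 0 ≤ m ∧ m < 1 ∧ ∀ n : ℕ, ∃ A : (Fin n → 𝒳) → Finset (Fin n → 𝒰),
      (∀ x, ∀ u ∈ A x, ∑ i, d (x i) (u i) ≤ n * (D + e)) ∧
      ∑ x with (#(A x) : ℝ) < 1 / 2 * Real.exp (n * (condEntropy P W - e)), ∏ i, P (x i) ≤
        4 * m ^ n := by
  obtain ⟨hW1, hWD⟩ := hW
  have hone : ∑ x, ∑ u, P x * W x u = 1 := by
    simp only [← mul_sum, (hW1 _).2, mul_one, hP.2]
  set h := condEntropy P W with hh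
  obtain ⟨m₁, hm₁, hm₁', hb₁⟩ := exists_chernoff_bound P hP W hW1 (fun x u => d x u - (D + e)) (by
    simp only [mul_sub, sum_sub_distrib, ← sum_mul, hone]
    linarith)
  obtain ⟨m₂, hm₂, hm₂', hb₂⟩ := exists_chernoff_bound P hP W hW1
    (fun x u => Real.log (W x u) + (h - e)) (by
    simp only [mul_add, sum_add_distrib, ← sum_mul, hone]
    have := condEntropy_eq P W
    linarith)
  refine ⟨max m₁ m₂, le_max_of_le_left hm₁, max_lt hm₁' hm₂', fun n => ?_⟩
  -- `B₁` holds the words of excessive distortion, `B₂` those of conditional probability too large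
  -- for the entropy. The summands have means at most `-e` and equal to `-e`, so both events are
  -- exponentially rare.
  set B₁ : (Fin n → 𝒳) → Finset (Fin n → 𝒰) := fun x =>
    {u | 0 ≤ ∑ i, (d (x i) (u i) - (D + e))} with hB₁
  set B₂ : (Fin n → 𝒳) → Finset (Fin n → 𝒰) := fun x =>
    {u | 0 ≤ ∑ i, (Real.log (W (x i) (u i)) + (h - e))} with hB₂
  classical
  have hPn : ∀ x : Fin n → 𝒳, 0 ≤ ∏ i, P (x i) := fun x => prod_nonneg fun i _ => hP.1 _
  have hWn : ∀ (x : Fin n → 𝒳) (u : Fin n → 𝒰), 0 ≤ ∏ i, W (x i) (u i) :=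
    fun x u => prod_nonneg fun i _ => (hW1 _).1 _
  refine ⟨fun x => (B₁ x ∪ B₂ x)ᶜ, ?_, ?_⟩
  · intro x u hu
    simp only [hB₁, hB₂, mem_compl, mem_union, mem_filter, mem_univ, true_and, not_or, not_le] at hu
    have := hu.1
    simp only [sum_sub_distrib, sum_const, card_univ, Fintype.card_fin, nsmul_eq_mul] at this
    linarith
  · have hlight : ∀ x : Fin n → 𝒳, ∑ u ∈ (B₁ x ∪ B₂ x)ᶜ, ∏ i, W (x i) (u i) ≤
        #((B₁ x ∪ B₂ x)ᶜ) * Real.exp (-(n * (h - e))) := by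
      intro x
      rw [← nsmul_eq_mul, ← sum_const]
      refine sum_le_sum fun u hu => ?_
      simp only [hB₁, hB₂, mem_compl, mem_union, mem_filter, mem_univ, true_and, not_or,
        not_le] at hu
      have hu2 := hu.2
      simp only [sum_add_distrib, sum_const, card_univ, Fintype.card_fin, nsmul_eq_mul] at hu2
      -- As `Real.log 0 = 0`, the sum of logarithms controls the product only when no factor
      -- vanishes.
      by_cases h0 : ∃ i, W (x i) (u i) = 0
      · obtain ⟨i, hi⟩ := h0
        rw [prod_eq_zero (mem_univ i) hi]
        positivity
      · push Not at h0
        have : ∏ i, W (x i) (u i) = Real.exp (∑ i, Real.log (W (x i) (u i))) := by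
          rw [Real.exp_sum]
          exact prod_congr rfl fun i _ =>
            (Real.exp_log (lt_of_le_of_ne ((hW1 _).1 _) (h0 i).symm)).symm
        rw [this]
        exact Real.exp_le_exp.2 (by linarith)
    -- Too few remaining words carry mass at most `1/2`, so `B₁ ∪ B₂` carries at least `1/2`.
    -- Markov's inequality then bounds the probability of such `x`.
    have hheavy : ∀ x : Fin n → 𝒳,
        (#((B₁ x ∪ B₂ x)ᶜ) : ℝ) < 1 / 2 * Real.exp (n * (h - e)) →
        1 ≤ 2 * (∑ u ∈ B₁ x, ∏ i, W (x i) (u i) + ∑ u ∈ B₂ x, ∏ i, W (x i) (u i)) := by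
      intro x hx
      have h1 : ∑ u ∈ (B₁ x ∪ B₂ x)ᶜ, ∏ i, W (x i) (u i) ≤ 1 / 2 := by
        refine (hlight x).trans ?_
        rw [Real.exp_neg, ← div_eq_mul_inv, div_le_iff₀ (Real.exp_pos _)]
        exact hx.le
      have h2 := sum_add_sum_compl (B₁ x ∪ B₂ x) fun u => ∏ i, W (x i) (u i)
      rw [sum_prod_eq_one (fun i => W (x i)) fun i => (hW1 _).2] at h2
      have h3 := sum_union_inter (s₁ := B₁ x) (s₂ := B₂ x) (f := fun u => ∏ i, W (x i) (u i))
      have h4 : 0 ≤ ∑ u ∈ B₁ x ∩ B₂ x, ∏ i, W (x i) (u i) := sum_nonneg fun u _ => hWn x u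
      linarith
    calc _ ≤ ∑ x : Fin n → 𝒳, (∏ i, P (x i)) *
          (2 * (∑ u ∈ B₁ x, ∏ i, W (x i) (u i) + ∑ u ∈ B₂ x, ∏ i, W (x i) (u i))) := by
          rw [sum_filter]
          refine sum_le_sum fun x _ => ?_
          split_ifs with hx
          · exact le_mul_of_one_le_right (hPn x) (hheavy x hx)
          · exact mul_nonneg (hPn x) (mul_nonneg two_pos.le (add_nonneg
              (sum_nonneg fun u _ => hWn x u) (sum_nonneg fun u _ => hWn x u)))
      _ = 2 * (∑ x : Fin n → 𝒳, (∏ i, P (x i)) * ∑ u ∈ B₁ x, ∏ i, W (x i) (u i) +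
            ∑ x : Fin n → 𝒳, (∏ i, P (x i)) * ∑ u ∈ B₂ x, ∏ i, W (x i) (u i)) := by
          rw [← sum_add_distrib, mul_sum]
          exact sum_congr rfl fun x _ => by ring
      _ ≤ 2 * (m₁ ^ n + m₂ ^ n) := by
          refine mul_le_mul_of_nonneg_left (add_le_add (hb₁ n) (hb₂ n)) two_pos.le
      _ ≤ 4 * max m₁ m₂ ^ n := by
          have h1 := pow_le_pow_left₀ hm₁ (le_max_left m₁ m₂) n
          have h2 := pow_le_pow_left₀ hm₂ (le_max_right m₁ m₂) n
          linarith

end Typicality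

/-! ### From parity-check matrices to coding schemes. -/

section Schemes

open Finset

theorem mem_groupCode {q k n : ℕ} (H : Matrix (Fin k) (Fin n) (ZMod q)) (u : Fin n → ZMod q) :
    u ∈ groupCode H ↔ H.mulVec u = 0 := by
  simp [groupCode]

/-- The scheme that sends the index of the codeword of least distortion. -/
theorem exists_minimum_distortion_scheme {𝒳 : Type*} {q k n : ℕ} [NeZero q] (d : 𝒳 → ZMod q → ℝ)
    (H : Matrix (Fin k) (Fin n) (ZMod q)) :
    ∃ S : GroupCodingScheme 𝒳 q n, S.k = k ∧ S.θ = #{u : Fin n → ZMod q | H.mulVec u = 0} ∧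
      ∀ x u, H.mulVec u = 0 → ∑ i, d (x i) (S.dec (S.enc x) i) ≤ ∑ i, d (x i) (u i) := by
  set K : Finset (Fin n → ZMod q) := {u | H.mulVec u = 0} with hK
  have hne : K.Nonempty := ⟨0, by simp [hK]⟩
  have hmin : ∀ x : Fin n → 𝒳, ∃ j : Fin #K, ∀ u ∈ K,
      ∑ i, d (x i) ((K.equivFin.symm j : Fin n → ZMod q) i) ≤ ∑ i, d (x i) (u i) := by
    intro x
    obtain ⟨v, hv, hvmin⟩ := K.exists_min_image (fun u => ∑ i, d (x i) (u i)) hne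
    exact ⟨K.equivFin ⟨v, hv⟩, fun u hu => by simpa using hvmin u hu⟩
  choose enc henc using hmin
  refine ⟨⟨k, H, #K, enc, fun j => (K.equivFin.symm j : Fin n → ZMod q), ?_⟩, rfl, rfl,
    fun x u hu => henc x u (by simpa [hK] using hu)⟩
  ext u
  simp only [Set.mem_range, SetLike.mem_coe, mem_groupCode]
  constructor
  · rintro ⟨j, rfl⟩
    exact (mem_filter.1 (K.equivFin.symm j).2).2
  · intro hu
    exact ⟨K.equivFin ⟨u, by simpa [hK] using hu⟩, by simp⟩

variable {𝒳 : Type*} [Fintype 𝒳]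

theorem sum_prod_source_eq_one (P : 𝒳 → ℝ) (hP : P ∈ stdSimplex ℝ 𝒳) (n : ℕ) :
    ∑ x : Fin n → 𝒳, ∏ i, P (x i) = 1 :=
  sum_prod_eq_one (fun _ => P) fun _ => hP.2

/-- As `0 ≤ D`, words in `B` may be charged `D + dmax` and all others `D`. -/
theorem GroupCodingScheme.expectedDistortion_le {q n : ℕ} [NeZero q] (hn : 0 < n)
    (P : 𝒳 → ℝ) (hP : P ∈ stdSimplex ℝ 𝒳) (d : 𝒳 → ZMod q → ℝ) {dmax D : ℝ}
    (hdmax : ∀ x u, d x u ≤ dmax) (hD : 0 ≤ D)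
    (S : GroupCodingScheme 𝒳 q n) (B : Finset (Fin n → 𝒳))
    (hB : ∀ x, x ∉ B → ∑ i, d (x i) (S.dec (S.enc x) i) ≤ n * D) :
    S.expectedDistortion P d ≤ D + dmax * ∑ x ∈ B, ∏ i, P (x i) := by
  classical
  have hPn : ∀ x : Fin n → 𝒳, 0 ≤ ∏ i, P (x i) := fun x => prod_nonneg fun i _ => hP.1 _
  have hn' : (0 : ℝ) < n := by exact_mod_cast hn
  have h1 : D + dmax * ∑ x ∈ B, ∏ i, P (x i) =
      ∑ x : Fin n → 𝒳, (∏ i, P (x i)) * (D + if x ∈ B then dmax else 0) := by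
    simp only [mul_add, sum_add_distrib, ← sum_mul, sum_prod_source_eq_one P hP n, one_mul,
      mul_ite, mul_zero, sum_ite_mem, univ_inter]
    rw [mul_comm]
  rw [h1, GroupCodingScheme.expectedDistortion]
  refine sum_le_sum fun x _ => mul_le_mul_of_nonneg_left ?_ (hPn x)
  rw [one_div, inv_mul_le_iff₀ hn']
  split_ifs with hx
  · calc _ ≤ ∑ _i : Fin n, dmax := sum_le_sum fun i _ => hdmax _ _
      _ = n * dmax := by simp
      _ ≤ _ := by gcongr; linarith
  · simpa using hB x hx

/-- The average of `f i / a + g i / b` is at most 2, while an index violating either bound makes it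
exceed 2. -/
theorem exists_le_two_mul_and_le_two_mul {β : Type*} [Fintype β] [Nonempty β] (f g : β → ℝ)
    {a b : ℝ} (hf : ∀ i, 0 ≤ f i) (hg : ∀ i, 0 ≤ g i) (ha : 0 < a) (hb : 0 < b)
    (hfa : ∑ i, f i ≤ Fintype.card β * a) (hgb : ∑ i, g i ≤ Fintype.card β * b) :
    ∃ i, f i ≤ 2 * a ∧ g i ≤ 2 * b := by
  by_contra! hcon
  have h1 : ∀ i, 2 < f i / a + g i / b := by
    intro i
    rcases le_or_gt (f i) (2 * a) with h | h
    · have := (lt_div_iff₀ hb).2 (hcon i h)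
      have := div_nonneg (hf i) ha.le
      linarith
    · have := (lt_div_iff₀ ha).2 h
      have := div_nonneg (hg i) hb.le
      linarith
  have h2 := sum_lt_sum_of_nonempty (univ_nonempty (α := β)) fun i _ => h1 i
  rw [sum_add_distrib, ← sum_div, ← sum_div, sum_const, card_univ, nsmul_eq_mul] at h2
  have h3 := (div_le_iff₀ ha).2 hfa
  have h4 := (div_le_iff₀ hb).2 hgb
  linarith

variable {p r : ℕ} [Fact p.Prime]

/-- A parity-check matrix whose group code is not much larger than `p^(r(n-k))` and meets all but
a small part of a family of sufficiently large sets. -/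
theorem exists_covering_matrix (hr : 1 ≤ r) {n k : ℕ} (hn : 0 < n) (hk : k ≤ n)
    (P : 𝒳 → ℝ) (hP : P ∈ stdSimplex ℝ 𝒳) (A : (Fin n → 𝒳) → Finset (Fin n → ZMod (p ^ r)))
    {E β ρ : ℝ} (hβ : 0 ≤ β) (hρ : 0 < ρ)
    (hbad : ∑ x with (#(A x) : ℝ) < 1 / 2 * E, ∏ i, P (x i) ≤ β)
    (hE : ((p : ℝ) ^ (r - 1)) ^ n ≤ 1 / 4 * E)
    (hEρ : r * (p : ℝ) ^ r * (p : ℝ) ^ ((r - 1) * n + k) ≤ ρ * (1 / 4 * E)) :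
    ∃ H : Matrix (Fin k) (Fin n) (ZMod (p ^ r)),
      (#{u : Fin n → ZMod (p ^ r) | H.mulVec u = 0} : ℝ) ≤
        2 * ((r + 1) * ((p : ℝ) ^ r) ^ (n - k)) ∧
      ∑ x with ∀ u ∈ A x, H.mulVec u ≠ 0, ∏ i, P (x i) ≤ 2 * (β + ρ) := by
  have : Nonempty (Fin n) := ⟨⟨0, hn⟩⟩
  have hp : 0 < p := (Fact.out : p.Prime).pos
  have hp0 : (0 : ℝ) < p := by exact_mod_cast hp
  have hPn : ∀ x : Fin n → 𝒳, 0 ≤ ∏ i, P (x i) := fun x => prod_nonneg fun i _ => hP.1 _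
  set T : ℝ := ((p : ℝ) ^ r) ^ (n * k) with hT
  have hT0 : 0 < T := by positivity
  have hE0 : 0 < E := by
    have : 0 < ((p : ℝ) ^ (r - 1)) ^ n := by positivity
    linarith
  have hcard : (Fintype.card (Matrix (Fin k) (Fin n) (ZMod (p ^ r))) : ℝ) = T := by
    rw [← Nat.card_eq_fintype_card, Nat.card_congr (Matrix.of (m := Fin k) (n := Fin n)).symm]
    simp [hT, pow_mul]
  refine exists_le_two_mul_and_le_two_mul _ _ (fun H => by positivity)
    (fun H => sum_nonneg fun x _ => hPn x) (by positivity) (by positivity) ?_ ?_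
  · rw [hcard]
    simpa using sum_card_ker_le (p := p) (r := r) (ι := Fin n) k (by simpa using hk)
  rw [hcard]
  have hmiss : ∀ x, ¬ (#(A x) : ℝ) < 1 / 2 * E →
      (#{H : Matrix (Fin k) (Fin n) (ZMod (p ^ r)) | ∀ u ∈ A x, H.mulVec u ≠ 0} : ℝ) ≤ T * ρ := by
    intro x hx
    -- Dropping the words without a unit coordinate loses at most `E / 4` of at least `E / 2` words.
    set A' : Finset (Fin n → ZMod (p ^ r)) := {u ∈ A x | ∃ i, IsUnit (u i)} with hA'
    have h1 := card_matrix_missing_le hr k (by simpa using hk) A' (fun u hu => (mem_filter.1 hu).2)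
    have h2 : (1 / 4 * E) ≤ (#A' : ℝ) := by
      have h3 : (#(A x) : ℝ) = #A' + #{u ∈ A x | ¬ ∃ i, IsUnit (u i)} := by
        exact_mod_cast (card_filter_add_card_filter_not (s := A x) fun u => ∃ i, IsUnit (u i)).symm
      have h4 : (#{u ∈ A x | ¬ ∃ i, IsUnit (u i)} : ℝ) ≤ ((p : ℝ) ^ (r - 1)) ^ n := by
        have h5 : #{u ∈ A x | ¬ ∃ i, IsUnit (u i)} ≤ (p ^ (r - 1)) ^ n := by
          refine (card_le_card fun u hu => ?_).trans
            ((card_forall_not_isUnit_le (p := p) (ι := Fin n) hr).trans_eq (by simp))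
          simpa using (mem_filter.1 hu).2
        exact_mod_cast h5
      linarith
    have h6 : (#{H : Matrix (Fin k) (Fin n) (ZMod (p ^ r)) | ∀ u ∈ A x, H.mulVec u ≠ 0} : ℝ) ≤
        #{H : Matrix (Fin k) (Fin n) (ZMod (p ^ r)) | ∀ u ∈ A', H.mulVec u ≠ 0} := by
      exact_mod_cast card_le_card fun H hH => by
        simp only [mem_filter, mem_univ, true_and] at hH ⊢
        exact fun u hu => hH u (mem_filter.1 hu).1
    refine h6.trans ?_
    simp only [Fintype.card_fin] at h1
    have h7 : (0 : ℝ) < 1 / 4 * E := by linarith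
    refine le_of_mul_le_mul_right ?_ h7
    calc _ ≤ (#{H : Matrix (Fin k) (Fin n) (ZMod (p ^ r)) | ∀ u ∈ A', H.mulVec u ≠ 0} : ℝ) * #A' :=
          by gcongr
      _ ≤ _ := h1
      _ ≤ T * (ρ * (1 / 4 * E)) := by gcongr
      _ = _ := by ring
  have hmiss' : ∀ x, (#{H : Matrix (Fin k) (Fin n) (ZMod (p ^ r)) |
      ∀ u ∈ A x, H.mulVec u ≠ 0} : ℝ) ≤ T := by
    intro x
    rw [← hcard]
    exact_mod_cast card_le_univ _
  calc _ = ∑ x : Fin n → 𝒳, (∏ i, P (x i)) *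
        (#{H : Matrix (Fin k) (Fin n) (ZMod (p ^ r)) | ∀ u ∈ A x, H.mulVec u ≠ 0} : ℝ) := by
        simp only [sum_filter]
        rw [sum_comm]
        refine sum_congr rfl fun x _ => ?_
        rw [← sum_filter, sum_const, nsmul_eq_mul, mul_comm]
    _ ≤ ∑ x : Fin n → 𝒳, ((if (#(A x) : ℝ) < 1 / 2 * E then T * ∏ i, P (x i) else 0) +
          (∏ i, P (x i)) * (T * ρ)) := by
        refine sum_le_sum fun x _ => ?_
        split_ifs with hx
        · have h1 := mul_le_mul_of_nonneg_left (hmiss' x) (hPn x)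
          have h2 : 0 ≤ (∏ i, P (x i)) * (T * ρ) := mul_nonneg (hPn x) (by positivity)
          linarith
        · have h1 := mul_le_mul_of_nonneg_left (hmiss x hx) (hPn x)
          linarith
    _ = T * ∑ x with (#(A x) : ℝ) < 1 / 2 * E, ∏ i, P (x i) + T * ρ := by
        rw [sum_add_distrib, ← sum_filter, mul_sum, ← sum_mul, sum_prod_source_eq_one P hP n,
          one_mul]
    _ ≤ T * β + T * ρ := by gcongr
    _ = _ := by ring

end Schemes

/-! ### Choice of parameters, and the minimum over test channels. -/

section Achievability

variable {𝒳 : Type*} [Fintype 𝒳]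

open Finset

theorem exists_scheme_of_matrix {q k n : ℕ} [NeZero q] (hn : 0 < n) (P : 𝒳 → ℝ)
    (hP : P ∈ stdSimplex ℝ 𝒳) (d : 𝒳 → ZMod q → ℝ) {dmax D : ℝ} (hdmax : ∀ x u, d x u ≤ dmax)
    (hD : 0 ≤ D) (H : Matrix (Fin k) (Fin n) (ZMod q))
    (A : (Fin n → 𝒳) → Finset (Fin n → ZMod q))
    (hA : ∀ x, ∀ u ∈ A x, ∑ i, d (x i) (u i) ≤ n * D) :
    ∃ S : GroupCodingScheme 𝒳 q n, S.k = k ∧ S.θ = #{u : Fin n → ZMod q | H.mulVec u = 0} ∧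
      S.expectedDistortion P d ≤
        D + dmax * ∑ x with ∀ u ∈ A x, H.mulVec u ≠ 0, ∏ i, P (x i) := by
  obtain ⟨S, hk, hθ, hS⟩ := exists_minimum_distortion_scheme d H
  refine ⟨S, hk, hθ, S.expectedDistortion_le hn P hP d hdmax hD _ fun x hx => ?_⟩
  simp only [mem_filter, mem_univ, true_and, not_forall, not_not] at hx
  obtain ⟨u, hu, hHu⟩ := hx
  exact (hS x u hHu).trans (hA x u hu)

variable {p r : ℕ} [Fact p.Prime]

theorem zero_le_of_mem_testChannels {𝒰 : Type*} [Fintype 𝒰] {P : 𝒳 → ℝ}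
    (hP : P ∈ stdSimplex ℝ 𝒳) {d : 𝒳 → 𝒰 → ℝ} (hd : ∀ x u, 0 ≤ d x u) {D : ℝ}
    {W : 𝒳 → 𝒰 → ℝ} (hW : W ∈ testChannels P d D) : 0 ≤ D :=
  le_trans (sum_nonneg fun x _ => sum_nonneg fun u _ =>
    mul_nonneg (mul_nonneg (hP.1 x) ((hW.1 x).1 u)) (hd x u)) hW.2

theorem exists_distortion_bound {𝒰 : Type*} [Fintype 𝒰] (d : 𝒳 → 𝒰 → ℝ) :
    ∃ dmax : ℝ, 0 ≤ dmax ∧ ∀ x u, d x u ≤ dmax := by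
  refine ⟨∑ x, ∑ u, |d x u|, by positivity, fun x u => (le_abs_self _).trans ?_⟩
  refine (single_le_sum (f := fun u => |d x u|) (fun _ _ => abs_nonneg _) (mem_univ u)).trans ?_
  exact single_le_sum (f := fun x => ∑ u, |d x u|) (fun _ _ => by positivity) (mem_univ x)

/-- The whole space `(ℤ/q)ⁿ`, as the group code of the parity-check matrix without rows, achieves
the rate `log q`. -/
theorem groupAchievable_log_card {q : ℕ} [NeZero q] (P : 𝒳 → ℝ) (hP : P ∈ stdSimplex ℝ 𝒳)
    (d : 𝒳 → ZMod q → ℝ) (hd : ∀ x u, 0 ≤ d x u) (D : ℝ) (W : 𝒳 → ZMod q → ℝ)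
    (hW : W ∈ testChannels P d D) : GroupAchievable P d (Real.log q) D := by
  intro ε hε
  obtain ⟨dmax, hdmax0, hdmax⟩ := exists_distortion_bound d
  have hD0 := zero_le_of_mem_testChannels hP hd hW
  obtain ⟨m, hm0, hm1, hm⟩ :=
    exists_many_words_within_distortion P hP d D W hW (ε / 2) (by positivity)
  have hlim : Tendsto (fun n : ℕ => dmax * (4 * m ^ n)) atTop (nhds 0) := by
    simpa using ((tendsto_pow_atTop_nhds_zero_of_lt_one hm0 hm1).const_mul 4).const_mul dmax
  filter_upwards [hlim.eventually_le_const (half_pos hε), eventually_gt_atTop 0] with n h1 hn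
  obtain ⟨A, hA, hbad⟩ := hm n
  obtain ⟨S, hk, hθ, hS⟩ := exists_scheme_of_matrix hn P hP d hdmax (by positivity)
    (0 : Matrix (Fin 0) (Fin n) (ZMod q)) A hA
  have hn' : (0 : ℝ) < n := by exact_mod_cast hn
  refine ⟨S, ?_, ?_, ?_⟩
  · have : S.θ = q ^ n := by
      rw [hθ, filter_true_of_mem (fun u _ => Subsingleton.elim _ _), card_univ]
      simp [ZMod.card]
    rw [this, Nat.cast_pow, Real.log_pow]
    field_simp
    linarith
  · rw [hk]
    simp [hε.le]
  · have h2 : ∑ x with ∀ u ∈ A x, (0 : Matrix (Fin 0) (Fin n) (ZMod q)).mulVec u ≠ 0,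
        ∏ i, P (x i) ≤ 4 * m ^ n := by
      refine le_trans (sum_le_sum_of_subset_of_nonneg (fun x hx => ?_)
        fun x _ _ => prod_nonneg fun i _ => hP.1 _) hbad
      simp only [mem_filter, mem_univ, true_and] at hx ⊢
      -- Without rows every word is a codeword, so `x` is missed only when `A x` is empty.
      have : A x = ∅ := eq_empty_of_forall_notMem fun u hu => hx u hu (Subsingleton.elim _ _)
      rw [this]
      simp only [card_empty, Nat.cast_zero]
      positivity
    have h3 := mul_le_mul_of_nonneg_left h2 hdmax0
    linarith

/-- Achievability by random parity-check matrices, for a test channel whose conditional entropy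
exceeds `log p^(r-1)`. -/
theorem groupAchievable_of_log_lt_condEntropy (hr : 1 ≤ r) (P : 𝒳 → ℝ)
    (hP : P ∈ stdSimplex ℝ 𝒳) (d : 𝒳 → ZMod (p ^ r) → ℝ) (hd : ∀ x u, 0 ≤ d x u) (D : ℝ)
    (W : 𝒳 → ZMod (p ^ r) → ℝ) (hW : W ∈ testChannels P d D)
    (hl : Real.log ((p : ℝ) ^ (r - 1)) < condEntropy P W) :
    GroupAchievable P d
      (Real.log ((p : ℝ) ^ r) - r * (condEntropy P W - Real.log ((p : ℝ) ^ (r - 1)))) D := by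
  intro ε hε
  obtain ⟨dmax, hdmax0, hdmax⟩ := exists_distortion_bound d
  have hD0 := zero_le_of_mem_testChannels hP hd hW
  have hp1 : (1 : ℝ) < p := by exact_mod_cast (Fact.out : p.Prime).one_lt
  have hp0 : (0 : ℝ) < p := by linarith
  have hr0 : (0 : ℝ) < r := by exact_mod_cast hr
  set L := Real.log p with hL
  have hL0 : 0 < L := Real.log_pos hp1
  set h := condEntropy P W with hh
  set l := h - Real.log ((p : ℝ) ^ (r - 1)) with hldef
  have hl0 : 0 < l := by linarith
  -- Used below to get `k ≤ n`.
  have hlL : l ≤ L := by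
    have h1 := condEntropy_le_log_card P hP W hW.1
    rw [ZMod.card, Nat.cast_pow] at h1
    have h2 : Real.log ((p : ℝ) ^ r) = L + Real.log ((p : ℝ) ^ (r - 1)) := by
      conv_lhs => rw [← Nat.sub_add_cancel hr, pow_succ]
      rw [Real.log_mul (by positivity) hp0.ne', add_comm]
    linarith
  -- `δ ≤ l` makes `l - δ` nonnegative; `δ ≤ ε / (2r)` limits the rate loss `r δ` to `ε / 2`.
  set δ := min l (ε / (2 * r)) with hδ
  have hδ0 : 0 < δ := lt_min hl0 (by positivity)
  have hδl : δ ≤ l := min_le_left _ _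
  have hδε : r * δ ≤ ε / 2 := by
    have := mul_le_mul_of_nonneg_left (min_le_right l (ε / (2 * r))) hr0.le
    have h2 : (r : ℝ) * (ε / (2 * r)) = ε / 2 := by field_simp
    linarith
  -- `e ≤ δ / 2` leaves an exponent of at least `δ / 2` for the covering, hence `s`; `e ≤ ε / 2` is
  -- the distortion slack.
  set e := min (δ / 2) (ε / 2) with he
  have he0 : 0 < e := lt_min (by positivity) (by positivity)
  have heδ : e ≤ δ / 2 := min_le_left _ _
  have heε : e ≤ ε / 2 := min_le_right _ _
  obtain ⟨m, hm0, hm1, hm⟩ := exists_many_words_within_distortion P hP d D W hW e he0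
  set s := Real.exp (-(δ / 2)) with hs
  have hs0 : 0 < s := Real.exp_pos _
  have hs1 : s < 1 :=
    lt_of_lt_of_eq (Real.exp_lt_exp.2 (show -(δ / 2) < 0 by linarith)) Real.exp_zero
  set C : ℝ := 4 * (r * (p : ℝ) ^ r) with hC
  have hC0 : 0 < C := by positivity
  have hslim : Tendsto (fun n : ℕ => s ^ n) atTop (nhds 0) :=
    tendsto_pow_atTop_nhds_zero_of_lt_one hs0.le hs1
  have hlim : Tendsto (fun n : ℕ => dmax * (2 * (4 * m ^ n + C * s ^ n))) atTop (nhds 0) := by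
    simpa using ((((tendsto_pow_atTop_nhds_zero_of_lt_one hm0 hm1).const_mul 4).add
      (hslim.const_mul C)).const_mul 2).const_mul dmax
  have hlim2 : Tendsto (fun n : ℕ => (r * L + Real.log (2 * (r + 1))) / (n : ℝ)) atTop (nhds 0) :=
    tendsto_const_div_atTop_nhds_zero_nat _
  filter_upwards [hlim.eventually_le_const (half_pos hε), hlim2.eventually_le_const (half_pos hε),
    hslim.eventually_le_const (show (0 : ℝ) < 1 / 4 by norm_num), eventually_gt_atTop 0]
    with n hn1 hn2 hn3 hn
  have hn' : (0 : ℝ) < n := by exact_mod_cast hn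
  obtain ⟨A, hA, hbad⟩ := hm n
  -- As many rows as the covering condition allows. Rounding loses at most one row, whose rate `r L
  -- / n` is absorbed through `hlim2`.
  set k := ⌊n * (l - δ) / L⌋₊ with hk
  have hk1 : (k : ℝ) * L ≤ n * (l - δ) := by
    rw [← le_div_iff₀ hL0]
    exact Nat.floor_le (div_nonneg (mul_nonneg hn'.le (by linarith)) hL0.le)
  have hk2 : n * (l - δ) ≤ k * L + L := by
    have := (Nat.lt_floor_add_one (n * (l - δ) / L)).le
    rw [div_le_iff₀ hL0] at this
    linarith
  have hkn : k ≤ n := by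
    have h1 : (k : ℝ) * L ≤ n * L := hk1.trans (by gcongr; linarith)
    exact_mod_cast le_of_mul_le_mul_right h1 hL0
  set E := Real.exp (n * (h - e)) with hE
  have hE0 : 0 < E := Real.exp_pos _
  have hpow : (p : ℝ) ^ ((r - 1) * n + k) ≤ s ^ n * E := by
    rw [hs, hE, ← Real.exp_nat_mul, ← Real.exp_add, ← Real.log_le_iff_le_exp (by positivity),
      Real.log_pow]
    have h1 : Real.log ((p : ℝ) ^ (r - 1)) = (r - 1 : ℕ) * L := by rw [Real.log_pow]
    have h2 : ((r - 1 : ℕ) : ℝ) * L = h - l := by rw [← h1, hldef]; ring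
    have h3 : (n : ℝ) * e ≤ n * (δ / 2) := by gcongr
    push_cast
    calc (((r - 1 : ℕ) : ℝ) * n + k) * L = n * (((r - 1 : ℕ) : ℝ) * L) + k * L := by ring
      _ ≤ n * (h - l) + n * (l - δ) := by rw [h2]; gcongr
      _ ≤ _ := by linarith
  obtain ⟨H, hH1, hH2⟩ := exists_covering_matrix hr hn hkn P hP A (E := E) (β := 4 * m ^ n)
    (ρ := C * s ^ n) (by positivity) (by positivity) hbad
    (by
      calc ((p : ℝ) ^ (r - 1)) ^ n ≤ (p : ℝ) ^ ((r - 1) * n + k) := by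
            rw [← pow_mul]
            exact pow_le_pow_right₀ hp1.le (Nat.le_add_right _ _)
        _ ≤ s ^ n * E := hpow
        _ ≤ _ := by gcongr)
    (by
      calc _ ≤ r * (p : ℝ) ^ r * (s ^ n * E) := by gcongr
        _ = _ := by rw [hC]; ring)
  obtain ⟨S, hSk, hSθ, hS⟩ := exists_scheme_of_matrix hn P hP d hdmax (by positivity) H A hA
  have hrate : (1 - (k : ℝ) / n) * (r * L) + Real.log (2 * (r + 1)) / n ≤ r * L - r * l + ε := by
    have h1 : (1 - (k : ℝ) / n) * (r * L) = r * L - r * (k * L) / n := by field_simp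
    have h2 : r * (l - δ) - r * L / n ≤ r * (k * L) / n := by
      rw [le_div_iff₀ hn', sub_mul, div_mul_cancel₀ _ hn'.ne']
      have := mul_le_mul_of_nonneg_left hk2 hr0.le
      linarith
    rw [add_div] at hn2
    linarith
  have hlog0 : 0 ≤ Real.log (2 * (r + 1)) / n :=
    div_nonneg (Real.log_nonneg (by linarith)) hn'.le
  have hlogq : Real.log ((p : ℝ) ^ r) = r * L := Real.log_pow _ _
  refine ⟨S, ?_, ?_, ?_⟩
  · have hθ0 : (0 : ℝ) < S.θ := by
      rw [hSθ]
      exact_mod_cast card_pos.2 ⟨0, by simp⟩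
    have h1 : Real.log (S.θ : ℝ) ≤ Real.log (2 * (r + 1)) + (n - k) * (r * L) := by
      rw [← hSθ] at hH1
      refine (Real.log_le_log hθ0 hH1).trans (le_of_eq ?_)
      rw [← mul_assoc, Real.log_mul (by positivity) (by positivity), Real.log_pow, hlogq,
        Nat.cast_sub hkn]
    rw [hlogq]
    refine le_trans (mul_le_mul_of_nonneg_left h1 (by positivity)) (le_trans (le_of_eq ?_) hrate)
    field_simp
    ring
  · rw [hSk, Nat.cast_pow, hlogq]
    linarith
  · have h3 := mul_le_mul_of_nonneg_left hH2 hdmax0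
    linarith

theorem GroupAchievable.mono {q : ℕ} {P : 𝒳 → ℝ} {d : 𝒳 → ZMod q → ℝ} {R R' D : ℝ}
    (h : GroupAchievable P d R D) (hR : R ≤ R') : GroupAchievable P d R' D := by
  intro ε hε
  filter_upwards [h ε hε] with n ⟨S, h1, h2, h3⟩
  exact ⟨S, h1.trans (by linarith), h2.trans (by linarith), h3⟩

/-- Only the second argument of the minimum matters: putting it in place of the minimum can only
lower the rate, and that lower rate is already achieved. -/
theorem groupAchievable_groupRate (hr : 1 ≤ r) (P : 𝒳 → ℝ) (hP : P ∈ stdSimplex ℝ 𝒳)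
    (d : 𝒳 → ZMod (p ^ r) → ℝ) (hd : ∀ x u, 0 ≤ d x u) (D : ℝ)
    (W : 𝒳 → ZMod (p ^ r) → ℝ) (hW : W ∈ testChannels P d D) :
    GroupAchievable P d (groupRate p r P W) D := by
  rcases lt_or_ge (Real.log ((p : ℝ) ^ (r - 1))) (condEntropy P W) with h | h
  · refine (groupAchievable_of_log_lt_condEntropy hr P hP d hd D W hW h).mono ?_
    rw [groupRate, max_eq_left (by linarith)]
    linarith [min_le_right (condEntropy P W)
      (r * (condEntropy P W - Real.log ((p : ℝ) ^ (r - 1))))]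
  · refine (groupAchievable_log_card P hP d hd D W hW).mono ?_
    rw [groupRate, max_eq_right (by linarith), mul_zero, Nat.cast_pow]
    linarith [min_le_right (condEntropy P W) 0]

theorem isCompact_testChannels {𝒰 : Type*} [Fintype 𝒰] (P : 𝒳 → ℝ) (d : 𝒳 → 𝒰 → ℝ) (D : ℝ) :
    IsCompact (testChannels P d D) := by
  have h1 : IsCompact (Set.univ.pi fun _ : 𝒳 => stdSimplex ℝ 𝒰) :=
    isCompact_univ_pi fun _ => isCompact_stdSimplex ℝ 𝒰
  have h2 : IsClosed {W : 𝒳 → 𝒰 → ℝ | ∑ x, ∑ u, P x * W x u * d x u ≤ D} :=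
    isClosed_le (by fun_prop) continuous_const
  have h3 := h1.inter_right h2
  convert h3 using 1
  ext W
  simp [testChannels]

theorem continuous_groupRate (P : 𝒳 → ℝ) : Continuous (groupRate p r P) := by
  have h : Continuous fun W : 𝒳 → ZMod (p ^ r) → ℝ => condEntropy P W := by
    unfold condEntropy
    exact continuous_finsetSum _ fun x _ => continuous_const.mul
      (continuous_finsetSum _ fun u _ => Real.continuous_negMulLog.comp (by fun_prop))
  unfold groupRate
  fun_prop

end Achievability

theorem corollary2 {𝒳 : Type*} [Fintype 𝒳] (p r : ℕ) [Fact p.Prime] (hr : 1 ≤ r)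
    (P : 𝒳 → ℝ) (hP : P ∈ stdSimplex ℝ 𝒳)
    (d : 𝒳 → ZMod (p ^ r) → ℝ) (hd : ∀ x u, 0 ≤ d x u)
    (D : ℝ) (hD : (testChannels P d D).Nonempty) :
    ∃ R₀ : ℝ, IsLeast (groupRate p r P '' testChannels P d D) R₀ ∧
      ∀ R : ℝ, R₀ ≤ R → GroupAchievable P d R D := by
  obtain ⟨R₀, hR₀⟩ := ((isCompact_testChannels P d D).image
    (continuous_groupRate P)).exists_isLeast (hD.image _)
  refine ⟨R₀, hR₀, fun R hR => ?_⟩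
  obtain ⟨W, hW, rfl⟩ := hR₀.1
  exact (groupAchievable_groupRate hr P hP d hd D W hW).mono hR
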